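/- Let $N$ be a connected, simply connected, nilpotent (real, finite-dimensional) Lie group, and let $Y, T$ be two non-zero left-invariant vector fields on $N$. Then there exists a non-zero, smooth, compactly supported function $f : N \to \mathbf{R}$ whose integral along every orbit of $Y$ and along every orbit of $T$ is zero. Explicitly: the fields $V \in \{Y, T\}$ are complete, and for every integral curve $\gamma : \mathbf{R} \to N$ of $V$ (that is, $\gamma'(t) = V(\gamma(t))$ for all $t$), the function $t \mapsto f(\gamma(t))$ is integrable on $\mathbf{R}$ and $\int_{\mathbf{R}} f(\gamma(t))\,dt = 0$. -/

import Mathlib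

open scoped Manifold ContDiff

/-- The integral of `f` along every orbit of the vector field `V` is zero. Orbits are parametrized
by the flow of `V`: a complete integral curve passes through every point, and for each
complete integral curve `γ` the function `t ↦ f (γ t)` is integrable on `ℝ` with integral zero. -/
def HasZeroOrbitIntegrals {E : Type*} [NormedAddCommGroup E] [NormedSpace ℝ E]
    {H : Type*} [TopologicalSpace H] {I : ModelWithCorners ℝ E H}
    {M : Type*} [TopologicalSpace M] [ChartedSpace H M]
    (V : (x : M) → TangentSpace I x) (f : M → ℝ) : Prop :=
  (∀ x : M, ∃ γ : ℝ → M, γ 0 = x ∧ IsMIntegralCurve γ V) ∧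
    ∀ γ : ℝ → M, IsMIntegralCurve γ V →
      MeasureTheory.Integrable (fun t : ℝ => f (γ t)) ∧ ∫ t : ℝ, f (γ t) = 0

/-! The orbits of `Y` are the curves `x * a t` for a one-parameter subgroup `a`. If `a` is proper,
`h (x * a 1) - h x` has zero integral along each of them, being the difference of a translate in `t`
and the original. With `b` the subgroup of `T`, it remains to solve `h (x * a 1) - h x = k (x * b 1)
- k x` with `h ≠ 0`. `exists_sub_eq_sub` does so by induction along the upper central series,
replacing `a 1` by a conjugate of `b 1`. Properness also makes right translation by `a 1` or `b 1`
fix no nonzero compactly supported function, so nothing degenerates to zero.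

Properness is obtained from the squaring map instead of the exponential. Nilpotency makes its
derivative invertible and its fibres orbits of a central group, so it is a covering, hence injective
by simple connectedness. Small neighborhoods of the identity are then closed under square roots, and
repeated halving of `t` shows that `c t` cannot return to them for large `t`. -/

section Preliminaries

open scoped commutatorElement
open Filter Topology

/-! ### Squares in nilpotent groups -/

section NilpotentGroups

variable {G : Type*} [Group G] [Group.IsNilpotent G]

/-- In a nilpotent group, the quotient of two elements with the same square is a `2`-power torsion
element. -/
theorem exists_pow_two_pow_eq_one_of_mul_self_eq {x y : G} (h : x * x = y * y) :
    ∃ k : ℕ, (x * y⁻¹) ^ 2 ^ k = 1 := by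
  obtain ⟨c, hc⟩ := Group.IsNilpotent.nilpotent G
  -- Conjugation by `y` inverts `z = x * y⁻¹`, so `⁅z ^ 2 ^ k, y⁆ = z ^ 2 ^ (k + 1)`: each squaring
  -- descends one term of the upper central series.
  have hconj : y * (x * y⁻¹) * y⁻¹ = (x * y⁻¹)⁻¹ := by
    have : y * x * y⁻¹ * y⁻¹ * x = y := by
      calc y * x * y⁻¹ * y⁻¹ * x = y * x * (y * y)⁻¹ * x := by group
        _ = y := by rw [← h]; group
    rw [eq_inv_iff_mul_eq_one]
    calc y * (x * y⁻¹) * y⁻¹ * (x * y⁻¹) = (y * x * y⁻¹ * y⁻¹ * x) * y⁻¹ := by group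
      _ = 1 := by rw [this]; group
  have key : ∀ k ≤ c, (x * y⁻¹) ^ 2 ^ k ∈ Subgroup.upperCentralSeries G (c - k) := by
    intro k
    induction k with
    | zero => intro _; simp [hc]
    | succ k ih =>
      intro hk
      have h1 := ih (by omega)
      rw [show c - k = (c - (k + 1)) + 1 by omega, Subgroup.mem_upperCentralSeries_succ_iff] at h1
      have h2 := h1 y
      have h3 : y * ((x * y⁻¹) ^ 2 ^ k)⁻¹ * y⁻¹ = (x * y⁻¹) ^ 2 ^ k := by
        have h3' : y * (x * y⁻¹) ^ 2 ^ k * y⁻¹ = ((x * y⁻¹) ^ 2 ^ k)⁻¹ := by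
          rw [← conj_pow, hconj, inv_pow]
        generalize (x * y⁻¹) ^ 2 ^ k = b at h3'
        calc y * b⁻¹ * y⁻¹ = (y * b * y⁻¹)⁻¹ := by group
          _ = b := by rw [h3', inv_inv]
      have h4 : (x * y⁻¹) ^ 2 ^ (k + 1) =
          (x * y⁻¹) ^ 2 ^ k * y * ((x * y⁻¹) ^ 2 ^ k)⁻¹ * y⁻¹ := by
        rw [mul_assoc, mul_assoc, ← mul_assoc y, h3, pow_succ, pow_mul, sq]
      rw [h4]
      simpa [commutatorElement_def] using h2
  exact ⟨c, by simpa using key c le_rfl⟩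

/-- A nilpotent group generated by its squares has all its elements squares. -/
theorem surjective_mul_self_of_closure_eq_top
    (h : Subgroup.closure (Set.range fun x : G => x * x) = ⊤) :
    Function.Surjective fun x : G => x * x := by
  let L := Subgroup.lowerCentralSeries (⊤ : Subgroup G)
  have hcomm : ∀ (i : ℕ) {a b : G}, a ∈ L i → ⁅a, b⁆ ∈ L (i + 1) := fun i a b ha =>
    Subgroup.commutator_mem_commutator ha (Subgroup.mem_top b)
  have hconj : ∀ (i : ℕ) {a : G} (b : G), a ∈ L i → b * a * b⁻¹ ∈ L i := fun i a b ha =>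
    (inferInstance : (L i).Normal).conj_mem a ha b
  have hstep : ∀ i, ∀ g ∈ L i, ∃ m ∈ L i, ∃ k ∈ L (i + 1), g = m * m * k := by
    intro i
    let S : Subgroup G :=
      { carrier := {g | ∃ m ∈ L i, ∃ k ∈ L (i + 1), g = m * m * k}
        one_mem' := ⟨1, one_mem _, 1, one_mem _, by simp⟩
        mul_mem' := by
          rintro _ _ ⟨m, hm, k, hk, rfl⟩ ⟨n, hn, l, hl, rfl⟩
          refine ⟨m * n, mul_mem hm hn, (n⁻¹ * ⁅m⁻¹, n⁻¹⁆ * n⁻¹⁻¹) *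
            ((n * n)⁻¹ * k * (n * n)⁻¹⁻¹) * l, mul_mem (mul_mem
              (hconj _ _ (hcomm i (inv_mem hm))) (hconj _ _ hk)) hl, ?_⟩
          simp [commutatorElement_def, mul_assoc]
        inv_mem' := by
          rintro _ ⟨m, hm, k, hk, rfl⟩
          refine ⟨m⁻¹, inv_mem hm, (m * m) * k⁻¹ * (m * m)⁻¹, hconj _ _ (inv_mem hk), ?_⟩
          group }
    -- Normality of `S` reduces commutators with products and inverses to commutators with squares,
    -- and `⁅p, x * x⁆` is `⁅p, x⁆` squared modulo the next term.
    have hSconj : ∀ b : G, ∀ g ∈ S, b * g * b⁻¹ ∈ S := by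
      rintro b _ ⟨m, hm, k, hk, rfl⟩
      exact ⟨b * m * b⁻¹, hconj _ _ hm, b * k * b⁻¹, hconj _ _ hk, by group⟩
    suffices L i ≤ S from this
    rcases i with _ | i
    · intro g _
      have : Subgroup.closure (Set.range fun x : G => x * x) ≤ S := by
        rw [Subgroup.closure_le]
        rintro _ ⟨x, rfl⟩
        exact ⟨x, Subgroup.mem_top x, 1, one_mem _, by simp⟩
      exact this (h ▸ Subgroup.mem_top g)
    · refine Subgroup.commutator_le.2 fun p hp q _ => ?_
      have hq : q ∈ Subgroup.closure (Set.range fun x : G => x * x) := h ▸ Subgroup.mem_top q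
      induction hq using Subgroup.closure_induction with
      | mem q hq =>
        obtain ⟨x, rfl⟩ := hq
        refine ⟨⁅p, x⁆, hcomm i hp, ⁅⁅p, x⁆⁻¹, x⁆, hcomm _ (inv_mem (hcomm i hp)), ?_⟩
        simp only [commutatorElement_def]
        group
      | one => simp [one_mem]
      | mul q r _ _ hq hr =>
        have : ⁅p, q * r⁆ = ⁅p, q⁆ * (q * ⁅p, r⁆ * q⁻¹) := by
          simp only [commutatorElement_def]
          group
        rw [this]
        exact mul_mem (hq trivial) (hSconj _ _ (hr trivial))
      | inv q _ hq =>
        have : ⁅p, q⁻¹⁆ = q⁻¹ * ⁅p, q⁆⁻¹ * q⁻¹⁻¹ := by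
          simp only [commutatorElement_def]
          group
        rw [this]
        exact hSconj _ _ (inv_mem (hq trivial))
  have key : ∀ i, ∀ g : G, ∃ m, ∃ k ∈ L i, g = m * m * k := by
    intro i
    induction i with
    | zero => exact fun g => ⟨1, g, Subgroup.mem_top g, by simp⟩
    | succ i ih =>
      intro g
      obtain ⟨m, k, hk, rfl⟩ := ih g
      obtain ⟨n, hn, l, hl, rfl⟩ := hstep i k hk
      refine ⟨m * n, (n⁻¹ * ⁅n⁻¹, m⁻¹⁆⁻¹ * n⁻¹⁻¹) * l,
        mul_mem (hconj _ _ (inv_mem (hcomm i (inv_mem hn)))) hl, ?_⟩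
      simp only [commutatorElement_def]
      group
  intro g
  obtain ⟨c, hc⟩ := Subgroup.nilpotent_iff_lowerCentralSeries.1 ‹Group.IsNilpotent G›
  obtain ⟨m, k, hk, rfl⟩ := key c g
  have : k = 1 := by simpa [L, hc] using hk
  exact ⟨m, by simp [this]⟩

end NilpotentGroups

/-! ### Squaring as a covering map, and properness of one-parameter subgroups -/

section Topological

variable {G : Type*} [Group G] [TopologicalSpace G] [IsTopologicalGroup G]

theorem Subgroup.eq_top_of_mem_nhds_one [ConnectedSpace G] (H : Subgroup G)
    (h : (H : Set G) ∈ nhds (1 : G)) : H = ⊤ := by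
  have hopen : IsOpen (H : Set G) := H.isOpen_of_mem_nhds h
  have hclopen : IsClopen (H : Set G) := ⟨H.isClosed_of_isOpen hopen, hopen⟩
  exact SetLike.coe_injective (by simpa using hclopen.eq_univ ⟨1, H.one_mem⟩)

/-- If squaring is locally injective on a connected topological group, `2`-power torsion elements
are central. -/
theorem mem_center_of_pow_two_pow_eq_one [ConnectedSpace G]
    (hinj : ∀ x : G, ∃ U ∈ nhds x, U.InjOn fun x => x * x) (k : ℕ) :
    ∀ z : G, z ^ 2 ^ k = 1 → z ∈ Subgroup.center G := by
  induction k with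
  | zero => intro z hz; simp at hz; simp [hz, one_mem]
  | succ k ih =>
    intro z hz
    have h2 := ih (z * z) (by rw [← sq, ← pow_mul, ← pow_succ', hz])
    obtain ⟨U, hU, hUinj⟩ := hinj z
    -- Since `z * z` is central, the conjugates of `z` all have the same square; those by `w` near 1
    -- lie near `z`, so they equal `z`.
    have : Subgroup.centralizer {z} = ⊤ := by
      apply Subgroup.eq_top_of_mem_nhds_one
      have hc : ContinuousAt (fun w : G => w * z * w⁻¹) 1 := by fun_prop
      filter_upwards [hc.preimage_mem_nhds (by simpa using hU)] with w hw
      have := hUinj hw (mem_of_mem_nhds hU) (by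
        have := Subgroup.mem_center_iff.1 h2 w
        simp only
        calc w * z * w⁻¹ * (w * z * w⁻¹) = (w * (z * z)) * w⁻¹ := by group
          _ = z * z := by rw [this]; group)
      rw [SetLike.mem_coe, Subgroup.mem_centralizer_singleton_iff]
      exact mul_inv_eq_iff_eq_mul.1 this
    rw [Subgroup.mem_center_iff]
    intro g
    have hg : g ∈ Subgroup.centralizer {z} := this ▸ Subgroup.mem_top g
    simpa [eq_comm] using Subgroup.mem_centralizer_singleton_iff.1 hg

/-- If squaring is open and locally injective on a connected nilpotent topological group, it is a
covering map. -/
theorem isCoveringMap_mul_self [ConnectedSpace G] [Group.IsNilpotent G]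
    (hopen : IsOpenMap fun x : G => x * x)
    (hinj : ∀ x : G, ∃ U ∈ nhds x, U.InjOn fun x => x * x) :
    IsCoveringMap fun x : G => x * x := by
  have hcont : Continuous fun x : G => x * x := by fun_prop
  have hsurj : Function.Surjective fun x : G => x * x := by
    apply surjective_mul_self_of_closure_eq_top
    apply Subgroup.eq_top_of_mem_nhds_one
    refine Filter.mem_of_superset (hopen.isOpen_range.mem_nhds ⟨1, by simp⟩)
      Subgroup.subset_closure
  -- The deck group of the covering: central elements with trivial square.
  let D : Subgroup G :=
    { carrier := {z | z ∈ Subgroup.center G ∧ z * z = 1}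
      one_mem' := ⟨one_mem _, by simp⟩
      mul_mem' := by
        rintro a b ⟨ha, ha'⟩ ⟨hb, hb'⟩
        refine ⟨mul_mem ha hb, ?_⟩
        have := Subgroup.mem_center_iff.1 ha b
        calc a * b * (a * b) = a * (b * a) * b := by group
          _ = (a * a) * (b * b) := by rw [this]; group
          _ = 1 := by rw [ha', hb', one_mul]
      inv_mem' := by
        rintro a ⟨ha, ha'⟩
        exact ⟨inv_mem ha, by rw [← mul_inv_rev, ha', inv_one]⟩ }
  have hD : ∀ (z : D) (x : G), (z • x) * (z • x) = x * x := by
    rintro ⟨z, hz, hz'⟩ x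
    have := Subgroup.mem_center_iff.1 hz x
    change z * x * (z * x) = x * x
    calc z * x * (z * x) = z * (x * z) * x := by group
      _ = (z * z) * (x * x) := by rw [this]; group
      _ = x * x := by rw [hz', one_mul]
  have : IsQuotientCoveringMap (fun x : G => x * x) D :=
    { hopen.isQuotientMap hcont hsurj with
      continuous_const_smul := fun z => continuous_const_mul (z : G)
      apply_eq_iff_mem_orbit := by
        intro x y
        constructor
        · intro h
          obtain ⟨k, hk⟩ := exists_pow_two_pow_eq_one_of_mul_self_eq h
          have hz := mem_center_of_pow_two_pow_eq_one hinj k _ hk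
          refine ⟨⟨x * y⁻¹, hz, ?_⟩, ?_⟩
          · have := Subgroup.mem_center_iff.1 hz y
            have h' : x * x = y * y := h
            have hx : x = y * (x * y⁻¹) := by rw [this]; group
            calc x * y⁻¹ * (x * y⁻¹) = y⁻¹ * (y * (x * y⁻¹)) * (x * y⁻¹) := by group
              _ = y⁻¹ * (x * x) * y⁻¹ := by rw [← hx]; group
              _ = 1 := by rw [h']; group
          · change x * y⁻¹ * y = x
            group
        · rintro ⟨z, rfl⟩
          exact hD z y
      disjoint := by
        intro x
        obtain ⟨U, hU, hUinj⟩ := hinj x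
        refine ⟨U, hU, ?_⟩
        rintro z ⟨_, ⟨u, hu, rfl⟩, hzu⟩
        have h1 : (z : G) * u = u := hUinj hzu hu (hD z u)
        exact Subtype.ext (by simpa using h1) }
  exact this.isCoveringMap

/-- A covering map from a connected space to a simply connected, locally path connected space is
injective. -/
theorem IsCoveringMap.injective_of_simplyConnectedSpace {X Y : Type*} [TopologicalSpace X]
    [TopologicalSpace Y] [PreconnectedSpace X] [SimplyConnectedSpace Y]
    [LocallyPathConnectedSpace Y] {p : X → Y} (hp : IsCoveringMap p) : Function.Injective p := by
  intro a b hab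
  -- `F` is a section of `p` through `a`; `F ∘ p` and `id` lift `p` and agree at `a`, so `F` is also
  -- a left inverse.
  obtain ⟨F, ⟨hFa, hF⟩, -⟩ := hp.existsUnique_continuousMap_lifts (ContinuousMap.id Y) (p a) a rfl
  have h := hp.eq_of_comp_eq (g₁ := F ∘ p) (g₂ := id) (F.continuous.comp hp.continuous)
    continuous_id (by rw [← Function.comp_assoc, hF]; rfl) a hFa
  have hb := congrFun h b
  simp only [Function.comp_apply, id] at hb
  rw [← hb, ← hab, hFa]

/-- If squaring is injective on a topological group and the identity has arbitrarily small
neighborhoods closed under square roots, nontrivial one-parameter subgroups are proper. -/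
theorem exists_abs_le_of_mem_isCompact [T2Space G]
    (hinj : Function.Injective fun x : G => x * x)
    (hroot : ∀ V ∈ nhds (1 : G), ∃ U ∈ nhds (1 : G), U ⊆ V ∧ ∀ x, x * x ∈ U → x ∈ U)
    {c : ℝ → G} (hc : Continuous c) (hadd : ∀ s t, c (s + t) = c s * c t)
    (hne : ∃ t, c t ≠ 1) {K : Set G} (hK : IsCompact K) :
    ∃ R : ℝ, ∀ t, c t ∈ K → |t| ≤ R := by
  have h0 : c 0 = 1 := by simpa using hadd 0 0
  have hneg : ∀ t, c (-t) = (c t)⁻¹ := fun t => by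
    rw [eq_inv_iff_mul_eq_one, ← hadd, neg_add_cancel, h0]
  have hhalf : ∀ t, c t = c (t / 2) * c (t / 2) := fun t => by rw [← hadd, add_halves]
  have hdiv : ∀ (t : ℝ) (n : ℕ), c t = 1 → c (t / 2 ^ n) = 1 := by
    intro t n ht
    induction n with
    | zero => simpa using ht
    | succ n ih =>
      apply hinj
      simp only
      rw [pow_succ, ← div_div, ← hhalf, ih, one_mul]
  -- A nonzero period could be halved indefinitely by injectivity of squaring, making the closed
  -- kernel dense.
  have hc1 : ∀ t > 0, c t ≠ 1 := by
    intro t ht h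
    obtain ⟨s, hs⟩ := hne
    let H : AddSubgroup ℝ :=
      { carrier := {r | c r = 1}
        zero_mem' := h0
        add_mem' := fun {a b} ha hb => by
          rw [Set.mem_ofPred_eq] at ha hb ⊢
          rw [hadd, ha, hb, one_mul]
        neg_mem' := fun {a} ha => by
          rw [Set.mem_ofPred_eq] at ha ⊢
          rw [hneg, ha, inv_one] }
    have hclosed : IsClosed (H : Set ℝ) := isClosed_singleton.preimage hc
    have hdense : Dense (H : Set ℝ) := by
      refine AddSubgroup.dense_of_not_isolated_zero H fun ε hε => ?_
      obtain ⟨n, hn⟩ := pow_unbounded_of_one_lt (t / ε) (one_lt_two : (1 : ℝ) < 2)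
      refine ⟨t / 2 ^ n, hdiv t n h, by positivity, ?_⟩
      rw [div_lt_iff₀ (by positivity)]
      rwa [div_lt_iff₀ hε, mul_comm] at hn
    exact hs (hclosed.closure_eq ▸ hdense s : s ∈ (H : Set ℝ))
  have hS : ∀ᶠ x in nhds (1 : G), x ∉ c '' Set.Icc 1 2 := by
    refine (isCompact_Icc.image hc).isClosed.isOpen_compl.mem_nhds ?_
    rintro ⟨t, ht, h⟩
    exact hc1 t (by linarith [ht.1]) h
  obtain ⟨U, hU, hUS, hUroot⟩ := hroot _ hS
  -- Taking square roots stays in `U` and halves `t`, eventually reaching `[1, 2]`, whose image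
  -- misses `U`.
  have hbig : ∀ n : ℕ, ∀ t : ℝ, 1 ≤ t → t ≤ 2 ^ (n + 1) → c t ∉ U := by
    intro n
    induction n with
    | zero => exact fun t h1 h2 h => hUS h ⟨t, ⟨h1, by simpa using h2⟩, rfl⟩
    | succ n ih =>
      intro t h1 h2 h
      rcases le_total t 2 with h3 | h3
      · exact hUS h ⟨t, ⟨h1, h3⟩, rfl⟩
      · rw [hhalf] at h
        exact ih (t / 2) (by linarith) (by rw [pow_succ] at h2; linarith) (hUroot _ h)
  have hlt : ∀ t, c t ∈ U → t < 1 := by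
    intro t ht
    by_contra! h
    obtain ⟨n, hn⟩ := pow_unbounded_of_one_lt t (one_lt_two : (1 : ℝ) < 2)
    exact hbig n t h (hn.le.trans (pow_le_pow_right₀ one_le_two (Nat.le_succ n))) ht
  have hdiff : ContinuousAt (fun q : G × G => q.1⁻¹ * q.2) (1, 1) := by fun_prop
  -- Two times at which `c` visits the same translate of `W` differ by less than 1; finitely many
  -- translates cover `K`.
  obtain ⟨W, hW, hWU⟩ : ∃ W ∈ nhds (1 : G), ∀ a ∈ W, ∀ b ∈ W, a⁻¹ * b ∈ U := by
    have := hdiff.preimage_mem_nhds (by simpa using hU)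
    rw [nhds_prod_eq, Filter.mem_prod_self_iff] at this
    obtain ⟨W, hW, h⟩ := this
    exact ⟨W, hW, fun a ha b hb => h (Set.mk_mem_prod ha hb)⟩
  refine hK.induction_on (p := fun K => ∃ R : ℝ, ∀ t, c t ∈ K → |t| ≤ R) ?_ ?_ ?_ ?_
  · exact ⟨0, by simp⟩
  · rintro s t hst ⟨R, hR⟩
    exact ⟨R, fun t ht => hR t (hst ht)⟩
  · rintro s t ⟨R, hR⟩ ⟨R', hR'⟩
    exact ⟨max R R', fun t ht => ht.elim (fun h => (hR t h).trans (le_max_left _ _))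
      fun h => (hR' t h).trans (le_max_right _ _)⟩
  · intro x _
    refine ⟨(fun y => x⁻¹ * y) ⁻¹' W, mem_nhdsWithin_of_mem_nhds
      (ContinuousAt.preimage_mem_nhds (by fun_prop) (by simpa using hW)), ?_⟩
    by_cases hex : ∃ s, c s ∈ (fun y => x⁻¹ * y) ⁻¹' W
    · obtain ⟨s, hs⟩ := hex
      refine ⟨|s| + 1, fun t ht => ?_⟩
      have e : ∀ a b : ℝ, c (b - a) = (x⁻¹ * c a)⁻¹ * (x⁻¹ * c b) := fun a b => by
        rw [sub_eq_neg_add, hadd, hneg]; group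
      have h1 := hlt (t - s) (by rw [e]; exact hWU _ hs _ ht)
      have h2 := hlt (s - t) (by rw [e]; exact hWU _ ht _ hs)
      have h3 : |t - s| ≤ 1 := abs_le.2 ⟨by linarith, by linarith⟩
      have := abs_sub_abs_le_abs_sub t s
      linarith
    · exact ⟨0, fun t ht => absurd ⟨t, ht⟩ hex⟩

end Topological

/-! ### Inverse function theorem on manifolds -/

section LocalInverse

variable {E : Type*} [NormedAddCommGroup E] [NormedSpace ℝ E] [CompleteSpace E]
  {M : Type*} [TopologicalSpace M] [ChartedSpace E M]

/-- A `C^1` map with invertible derivative at a point is open and injective near this point. -/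
theorem HasMFDerivAt.map_nhds_eq_and_injOn {f : M → M} {x : M}
    (hf : ContMDiffAt 𝓘(ℝ, E) 𝓘(ℝ, E) 1 f x) (A : E ≃L[ℝ] E)
    (hA : HasMFDerivAt 𝓘(ℝ, E) 𝓘(ℝ, E) f x (A : E →L[ℝ] E)) :
    map f (𝓝 x) = 𝓝 (f x) ∧ ∃ U ∈ 𝓝 x, U.InjOn f := by
  set F : E → E := writtenInExtChartAt 𝓘(ℝ, E) 𝓘(ℝ, E) x f with hF
  have hFd : HasFDerivAt F (A : E →L[ℝ] E) (extChartAt 𝓘(ℝ, E) x x) := by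
    have h := hA.2
    rw [ModelWithCorners.range_eq_univ] at h
    exact h.hasFDerivAt univ_mem
  have hFc : ContDiffAt ℝ 1 F (extChartAt 𝓘(ℝ, E) x x) := by
    have h := (contMDiffAt_iff.1 hf).2
    rw [ModelWithCorners.range_eq_univ] at h
    exact h.contDiffAt univ_mem
  have hFs := hFc.hasStrictFDerivAt' hFd one_ne_zero
  have hval : F (extChartAt 𝓘(ℝ, E) x x) = extChartAt 𝓘(ℝ, E) (f x) (f x) := by
    simp [hF, writtenInExtChartAt]
  have hFmap : map F (𝓝 (chartAt E x x)) = 𝓝 (chartAt E (f x) (f x)) := by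
    have := hFs.map_nhds_eq_of_equiv
    rw [hval] at this
    simpa using this
  obtain ⟨W, hW, hWinj⟩ : ∃ W ∈ 𝓝 (chartAt E x x), W.InjOn F := by
    refine ⟨(hFs.toOpenPartialHomeomorph F).source, ?_, ?_⟩
    · exact (hFs.toOpenPartialHomeomorph F).open_source.mem_nhds
        (by simpa using hFs.mem_toOpenPartialHomeomorph_source)
    · simpa using (hFs.toOpenPartialHomeomorph F).injOn
  have hsrc : ∀ᶠ u in 𝓝 x, u ∈ (chartAt E x).source := chart_source_mem_nhds E x
  have hsrc' : ∀ᶠ u in 𝓝 x, f u ∈ (chartAt E (f x)).source :=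
    hf.continuousAt.eventually_mem (chart_source_mem_nhds E (f x))
  have hFf : ∀ᶠ u in 𝓝 x, F (chartAt E x u) = chartAt E (f x) (f u) := by
    filter_upwards [hsrc] with u hu
    simp [hF, writtenInExtChartAt, hu]
  constructor
  · have h1 : f =ᶠ[𝓝 x] fun u => (chartAt E (f x)).symm (F (chartAt E x u)) := by
      filter_upwards [hFf, hsrc'] with u hu hu'
      rw [hu, (chartAt E (f x)).left_inv hu']
    rw [map_congr h1]
    change map ((chartAt E (f x)).symm ∘ F ∘ chartAt E x) (𝓝 x) = _
    rw [← map_map, ← map_map, (chartAt E x).map_nhds_eq (mem_chart_source E x), hFmap,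
      (chartAt E (f x)).symm_map_nhds_eq (mem_chart_source E (f x))]
  · refine ⟨{u | u ∈ (chartAt E x).source ∧ F (chartAt E x u) = chartAt E (f x) (f u) ∧
      chartAt E x u ∈ W}, ?_, ?_⟩
    · filter_upwards [hsrc, hFf, ((chartAt E x).continuousAt
        (mem_chart_source E x)).eventually_mem hW] with u h1 h2 h3 using ⟨h1, h2, h3⟩
    · rintro u ⟨hu1, hu2, hu3⟩ v ⟨hv1, hv2, hv3⟩ huv
      exact (chartAt E x).injOn hu1 hv1 (hWinj hu3 hv3 (by rw [hu2, hv2, huv]))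

end LocalInverse

/-! ### Derivative of squaring on a nilpotent Lie group -/

section LieGroup

variable {E : Type*} [NormedAddCommGroup E] [NormedSpace ℝ E]
  {N : Type*} [TopologicalSpace N] [ChartedSpace E N] [Group N] [LieGroup 𝓘(ℝ, E) ∞ N]

/-- The derivative at the identity of a product of maps fixing the identity. -/
theorem HasMFDerivAt.mul_one {f g : N → N} {A B : E →L[ℝ] E}
    (hf : HasMFDerivAt 𝓘(ℝ, E) 𝓘(ℝ, E) f 1 A) (hg : HasMFDerivAt 𝓘(ℝ, E) 𝓘(ℝ, E) g 1 B)
    (hf1 : f 1 = 1) (hg1 : g 1 = 1) :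
    HasMFDerivAt 𝓘(ℝ, E) 𝓘(ℝ, E) (fun u => f u * g u) 1 (A + B : E →L[ℝ] E) := by
  have hmul : MDifferentiableAt (𝓘(ℝ, E).prod 𝓘(ℝ, E)) 𝓘(ℝ, E)
      (fun p : N × N => p.1 * p.2) ((1 : N), (1 : N)) :=
    (contMDiff_mul 𝓘(ℝ, E) ∞).mdifferentiableAt (by simp)
  have h1 := hmul.hasMFDerivAt
  have h2 : mfderiv (𝓘(ℝ, E).prod 𝓘(ℝ, E)) 𝓘(ℝ, E) (fun p : N × N => p.1 * p.2)
      ((1 : N), (1 : N)) = (ContinuousLinearMap.fst ℝ E E + ContinuousLinearMap.snd ℝ E E :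
        E × E →L[ℝ] E) := by
    rw [mfderiv_prod_eq_add hmul]
    have e1 : (fun z : N × N => z.1 * ((1 : N), (1 : N)).2) = Prod.fst := by
      funext z; simp
    have e2 : (fun z : N × N => ((1 : N), (1 : N)).1 * z.2) = Prod.snd := by
      funext z; simp
    rw [e1, e2, mfderiv_fst, mfderiv_snd]
    rfl
  rw [h2] at h1
  have h3 := hf.prodMk hg
  have h4 : HasMFDerivAt (𝓘(ℝ, E).prod 𝓘(ℝ, E)) 𝓘(ℝ, E) (fun p : N × N => p.1 * p.2)
      (f 1, g 1) (ContinuousLinearMap.fst ℝ E E + ContinuousLinearMap.snd ℝ E E :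
        E × E →L[ℝ] E) := by
    rw [hf1, hg1]; exact h1
  convert! h4.comp (1 : N) h3 using 1

theorem contMDiff_commutatorElement (x : N) :
    ContMDiff 𝓘(ℝ, E) 𝓘(ℝ, E) ∞ fun u : N => ⁅x, u⁆ := by
  simp only [commutatorElement_def]
  have := topologicalGroup_of_lieGroup 𝓘(ℝ, E) ∞ (G := N)
  exact ((contMDiff_const.mul contMDiff_id).mul contMDiff_const).mul
    (contMDiff_id.inv)

/-- In a nilpotent Lie group, the derivative at the identity of a commutator map is nilpotent. -/
theorem exists_isNilpotent_hasMFDerivAt_commutatorElement [Group.IsNilpotent N] (x : N) :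
    ∃ K : E →L[ℝ] E, IsNilpotent K ∧
      HasMFDerivAt 𝓘(ℝ, E) 𝓘(ℝ, E) (fun u : N => ⁅x, u⁆) 1 K := by
  have hd : HasMFDerivAt 𝓘(ℝ, E) 𝓘(ℝ, E) (fun u : N => ⁅x, u⁆) 1
    (mfderiv 𝓘(ℝ, E) 𝓘(ℝ, E) (fun u : N => ⁅x, u⁆) 1) :=
    ((contMDiff_commutatorElement x).mdifferentiableAt (by simp)).hasMFDerivAt
  let K : E →L[ℝ] E := mfderiv 𝓘(ℝ, E) 𝓘(ℝ, E) (fun u : N => ⁅x, u⁆) 1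
  change HasMFDerivAt 𝓘(ℝ, E) 𝓘(ℝ, E) (fun u : N => ⁅x, u⁆) 1 K at hd
  refine ⟨K, ?_, hd⟩
  have hfix : ∀ n : ℕ, (fun u : N => ⁅x, u⁆)^[n] 1 = 1 := fun n =>
    Function.iterate_fixed (commutatorElement_one_right x) n
  have hiter : ∀ n : ℕ, HasMFDerivAt 𝓘(ℝ, E) 𝓘(ℝ, E) ((fun u : N => ⁅x, u⁆)^[n]) 1
      (K ^ n : E →L[ℝ] E) := by
    intro n
    induction n with
    | zero => exact hasMFDerivAt_id 1
    | succ n ih =>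
      rw [Function.iterate_succ', pow_succ']
      have h : HasMFDerivAt 𝓘(ℝ, E) 𝓘(ℝ, E) (fun u : N => ⁅x, u⁆)
          ((fun u : N => ⁅x, u⁆)^[n] 1) K := by rw [hfix]; exact hd
      exact h.comp (1 : N) ih
  obtain ⟨c, hc⟩ := Subgroup.nilpotent_iff_lowerCentralSeries.1 ‹Group.IsNilpotent N›
  have hmem : ∀ (n : ℕ) (u : N), (fun u : N => ⁅x, u⁆)^[n] u ∈
      Subgroup.lowerCentralSeries (⊤ : Subgroup N) n := by
    intro n u
    induction n with
    | zero => exact Subgroup.mem_top u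
    | succ n ih =>
      rw [Function.iterate_succ_apply', ← commutatorElement_inv]
      exact inv_mem (Subgroup.commutator_mem_commutator ih (Subgroup.mem_top x))
  -- Iterated commutators end in the trivial term of the lower central series, so `K ^ c` is the
  -- derivative of a constant.
  have hconst : (fun u : N => ⁅x, u⁆)^[c] = fun _ => 1 := by
    funext u
    simpa [hc] using hmem c u
  refine ⟨c, ?_⟩
  have h1 := hiter c
  rw [hconst] at h1
  exact hasMFDerivAt_unique h1 (hasMFDerivAt_const (1 : N) (1 : N))

/-- Squaring on a nilpotent Lie group is open and locally injective. -/
theorem map_nhds_mul_self_and_injOn [CompleteSpace E] [Group.IsNilpotent N] (y : N) :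
    map (fun x : N => x * x) (𝓝 y) = 𝓝 (y * y) ∧ ∃ U ∈ 𝓝 y, U.InjOn fun x : N => x * x := by
  have := topologicalGroup_of_lieGroup 𝓘(ℝ, E) ∞ (G := N)
  obtain ⟨K, hK, hKd⟩ := exists_isNilpotent_hasMFDerivAt_commutatorElement (E := E) y⁻¹
  have hid : HasMFDerivAt 𝓘(ℝ, E) 𝓘(ℝ, E) (fun u : N => u) 1 (1 : E →L[ℝ] E) :=
    hasMFDerivAt_id 1
  have hq := (hKd.mul_one hid (commutatorElement_one_right _) rfl).mul_one hid (by simp) rfl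
  -- With `x = y * u`, `x * x = y * y * (⁅y⁻¹, u⁆ * u * u)`; the last factor has derivative `K + 2`
  -- at 1, invertible as `K` is nilpotent.
  have hunit : IsUnit (K + 1 + 1) := by
    have h2 : IsUnit (1 + 1 : E →L[ℝ] E) := by
      rw [one_add_one_eq_two]
      have h := (IsUnit.mk0 (2 : ℝ) two_ne_zero).map (algebraMap ℝ (E →L[ℝ] E))
      rwa [map_ofNat] at h
    rw [add_assoc]
    refine hK.isUnit_add_right_of_commute h2 ?_
    exact (Commute.one_right K).add_right (Commute.one_right K)
  obtain ⟨A, hA⟩ := hunit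
  have hA' : ((ContinuousLinearEquiv.unitsEquiv ℝ E A : E ≃L[ℝ] E) : E →L[ℝ] E) = K + 1 + 1 := by
    rw [← hA]; rfl
  have hqs : ContMDiff 𝓘(ℝ, E) 𝓘(ℝ, E) ∞ fun u : N => ⁅y⁻¹, u⁆ * u * u :=
    ((contMDiff_commutatorElement y⁻¹).mul contMDiff_id).mul contMDiff_id
  obtain ⟨hmap, U, hU, hUinj⟩ := HasMFDerivAt.map_nhds_eq_and_injOn
    ((hqs.of_le (by simp)).contMDiffAt) _ (hA' ▸ hq)
  have heq : (fun x : N => x * x) =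
      (fun v => y * y * v) ∘ (fun u : N => ⁅y⁻¹, u⁆ * u * u) ∘ fun x => y⁻¹ * x := by
    funext x
    simp [commutatorElement_def, mul_assoc]
  have hleft : ∀ a b : N, map (fun x : N => a * x) (𝓝 b) = 𝓝 (a * b) := fun a b =>
    (Homeomorph.mulLeft a).map_nhds_eq b
  constructor
  · rw [heq, ← map_map, ← map_map, hleft, inv_mul_cancel, hmap]
    simp only [commutatorElement_one_right, _root_.mul_one]
    rw [hleft, _root_.mul_one]
  · refine ⟨(fun x => y⁻¹ * x) ⁻¹' U, ContinuousAt.preimage_mem_nhds (by fun_prop)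
      (by simpa using hU), ?_⟩
    rw [heq]
    intro a ha b hb hab
    exact mul_left_cancel (hUinj ha hb (mul_left_cancel hab))

/-- When squaring is open and injective on a Lie group, the identity has arbitrarily small
neighborhoods closed under square roots. -/
theorem exists_nhds_one_closed_under_sqrt (E : Type*) [NormedAddCommGroup E] [NormedSpace ℝ E]
    {N : Type*} [TopologicalSpace N] [ChartedSpace E N] [Group N] [LieGroup 𝓘(ℝ, E) ∞ N]
    (hopen : IsOpenMap fun x : N => x * x) (hinj : Function.Injective fun x : N => x * x)
    (V : Set N) (hV : V ∈ 𝓝 1) : ∃ U ∈ 𝓝 (1 : N), U ⊆ V ∧ ∀ x, x * x ∈ U → x ∈ U := by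
  have := topologicalGroup_of_lieGroup 𝓘(ℝ, E) ∞ (G := N)
  have hid : HasMFDerivAt 𝓘(ℝ, E) 𝓘(ℝ, E) (fun u : N => u) 1 (1 : E →L[ℝ] E) :=
    hasMFDerivAt_id 1
  set φ := chartAt E (1 : N) with hφ
  have h1 : (1 : N) ∈ φ.source := mem_chart_source E 1
  -- Squaring has derivative 2 at 1; an error of at most 1 times the distance leaves an expansion
  -- factor of at least 1.
  have hnear : ∀ᶠ u in 𝓝 (1 : N), ‖φ u - φ 1‖ ≤ ‖φ (u * u) - φ 1‖ := by
    have hd := (hid.mul_one hid rfl rfl).2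
    have hd' : HasFDerivAt (writtenInExtChartAt 𝓘(ℝ, E) 𝓘(ℝ, E) (1 : N) fun u => u * u)
        (1 + 1 : E →L[ℝ] E) (φ 1) := by
      rw [ModelWithCorners.range_eq_univ] at hd
      exact hd.hasFDerivAt univ_mem
    have h2 := (φ.continuousAt h1).eventually
      (hd'.isLittleO.bound (show (0 : ℝ) < 1 by norm_num))
    filter_upwards [h2, φ.open_source.mem_nhds h1] with u hu hus
    simp only [writtenInExtChartAt, Function.comp_apply, mfld_simps,
      _root_.mul_one, ← hφ, φ.left_inv hus, φ.left_inv h1] at hu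
    have h3 : (1 + 1 : E →L[ℝ] E) (φ u - φ 1) = (2 : ℝ) • (φ u - φ 1) := by
      simp [two_smul]
    have h4 : ‖(1 + 1 : E →L[ℝ] E) (φ u - φ 1)‖ = 2 * ‖φ u - φ 1‖ := by
      rw [h3, norm_smul]; simp
    have h5 := norm_sub_norm_le ((1 + 1 : E →L[ℝ] E) (φ u - φ 1)) (φ (u * u) - φ 1)
    rw [h4, norm_sub_rev ((1 + 1 : E →L[ℝ] E) (φ u - φ 1))] at h5
    linarith
  have hW : {u | ‖φ u - φ 1‖ ≤ ‖φ (u * u) - φ 1‖ ∧ u ∈ φ.source} ∈ 𝓝 (1 : N) :=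
    hnear.and (φ.open_source.mem_nhds h1)
  have hsq : (fun x : N => x * x) '' {u | ‖φ u - φ 1‖ ≤ ‖φ (u * u) - φ 1‖ ∧ u ∈ φ.source} ∈
      𝓝 (1 : N) := by
    simpa using hopen.image_mem_nhds hW
  have hsymm : ContinuousAt φ.symm (φ 1) := φ.continuousAt_symm (φ.map_source h1)
  have hpre := hsymm.preimage_mem_nhds (by rw [φ.left_inv h1]; exact inter_mem hV hsq)
  obtain ⟨r, hr, hball⟩ := Metric.mem_nhds_iff.1 hpre
  have hsub : ∀ u ∈ φ.source, ‖φ u - φ 1‖ < r → u ∈ V ∩ (fun x : N => x * x) ''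
      {u | ‖φ u - φ 1‖ ≤ ‖φ (u * u) - φ 1‖ ∧ u ∈ φ.source} := by
    intro u hu hur
    have := hball (mem_ball_iff_norm.2 hur)
    rwa [Set.mem_preimage, φ.left_inv hu] at this
  refine ⟨{u | u ∈ φ.source ∧ ‖φ u - φ 1‖ < r}, ?_, fun u hu => (hsub u hu.1 hu.2).1, ?_⟩
  · filter_upwards [φ.open_source.mem_nhds h1,
      (φ.continuousAt h1).eventually_mem (Metric.ball_mem_nhds _ hr)] with u hu hur
    exact ⟨hu, mem_ball_iff_norm.1 hur⟩
  · rintro x ⟨hx1, hx2⟩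
    -- Openness gives `x * x` a root `w` near 1; injectivity identifies it with `x`.
    obtain ⟨w, ⟨hw1, hw2⟩, hw⟩ := (hsub _ hx1 hx2).2
    obtain rfl : w = x := hinj hw
    exact ⟨hw2, hw1.trans_lt hx2⟩

/-- Nontrivial one-parameter subgroups of a simply connected nilpotent Lie group are proper. -/
theorem exists_abs_le_of_mem_isCompact_of_simplyConnectedSpace [CompleteSpace E]
    [T2Space N] [SimplyConnectedSpace N] [Group.IsNilpotent N]
    {c : ℝ → N} (hc : Continuous c) (hadd : ∀ s t, c (s + t) = c s * c t)
    (hne : ∃ t, c t ≠ 1) {K : Set N} (hK : IsCompact K) :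
    ∃ R : ℝ, ∀ t, c t ∈ K → |t| ≤ R := by
  have := topologicalGroup_of_lieGroup 𝓘(ℝ, E) ∞ (G := N)
  have : LocallyPathConnectedSpace N := ChartedSpace.locallyPathConnectedSpace E N
  have hopen : IsOpenMap fun x : N => x * x := IsOpenMap.of_nhds_le fun x =>
    (map_nhds_mul_self_and_injOn (E := E) x).1.ge
  have hinj := (isCoveringMap_mul_self hopen
    fun x => (map_nhds_mul_self_and_injOn (E := E) x).2).injective_of_simplyConnectedSpace
  exact exists_abs_le_of_mem_isCompact hinj
    (exists_nhds_one_closed_under_sqrt E hopen hinj) hc hadd hne hK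

end LieGroup

/-! ### Integral curves of left-invariant fields -/

section OneParameterSubgroups

variable {E : Type*} [NormedAddCommGroup E] [NormedSpace ℝ E]
  {N : Type*} [TopologicalSpace N] [ChartedSpace E N] [Group N] [LieGroup 𝓘(ℝ, E) ∞ N]

theorem mfderiv_mul_left_mulInvariantVectorField (Y : GroupLieAlgebra 𝓘(ℝ, E) N) (g x : N) :
    mfderiv 𝓘(ℝ, E) 𝓘(ℝ, E) (fun z : N => g * z) x (mulInvariantVectorField Y x) =
      mulInvariantVectorField Y (g * x) := by
  have hd : ∀ a b : N, MDifferentiableAt 𝓘(ℝ, E) 𝓘(ℝ, E) (fun z : N => a * z) b := fun a b =>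
    (contMDiff_mul_left (I := 𝓘(ℝ, E)) (n := ∞) (a := a)).mdifferentiableAt (by simp)
  have h : (fun z : N => g * x * z) = (fun z => g * z) ∘ fun z => x * z := by
    funext z
    simp [mul_assoc]
  have hx : x * 1 = x := _root_.mul_one x
  let D : N → E →L[ℝ] E := fun z => mfderiv 𝓘(ℝ, E) 𝓘(ℝ, E) (fun z : N => g * z) z
  have hD : D x = D (x * 1) := by rw [hx]
  simp only [mulInvariantVectorField]
  rw [h, mfderiv_comp (I' := 𝓘(ℝ, E)) (1 : N) (hd _ _) (hd _ _)]
  exact DFunLike.congr_fun hD _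

/-- Left translates of integral curves of a left-invariant vector field are integral curves. -/
theorem IsMIntegralCurveOn.mul_left {Y : GroupLieAlgebra 𝓘(ℝ, E) N} {γ : ℝ → N} {s : Set ℝ}
    (hγ : IsMIntegralCurveOn γ (mulInvariantVectorField Y) s) (g : N) :
    IsMIntegralCurveOn (fun t => g * γ t) (mulInvariantVectorField Y) s := by
  intro t ht
  have hd : HasMFDerivAt 𝓘(ℝ, E) 𝓘(ℝ, E) (fun z : N => g * z) (γ t)
      (mfderiv 𝓘(ℝ, E) 𝓘(ℝ, E) (fun z : N => g * z) (γ t)) :=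
    ((contMDiff_mul_left (I := 𝓘(ℝ, E)) (n := ∞) (a := g)).mdifferentiableAt
      (by simp)).hasMFDerivAt
  have h := hd.comp_hasMFDerivWithinAt t (hγ t ht)
  have e : ∀ (A : E →L[ℝ] E) (v : E), A.comp ((1 : ℝ →L[ℝ] ℝ).smulRight v) =
      (1 : ℝ →L[ℝ] ℝ).smulRight (A v) := fun A v => by
    ext
    simp
  rw [← mfderiv_mul_left_mulInvariantVectorField]
  exact e _ _ ▸ h

theorem IsMIntegralCurve.mul_left {Y : GroupLieAlgebra 𝓘(ℝ, E) N} {γ : ℝ → N}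
    (hγ : IsMIntegralCurve γ (mulInvariantVectorField Y)) (g : N) :
    IsMIntegralCurve (fun t => g * γ t) (mulInvariantVectorField Y) := by
  rw [isMIntegralCurve_iff_isMIntegralCurveOn] at hγ ⊢
  exact hγ.mul_left g

theorem contMDiff_one_mulInvariantVectorField (Y : GroupLieAlgebra 𝓘(ℝ, E) N) :
    ContMDiff 𝓘(ℝ, E) 𝓘(ℝ, E).tangent 1
      (fun g : N => (⟨g, mulInvariantVectorField Y g⟩ : TangentBundle 𝓘(ℝ, E) N)) := by
  have : LieGroup 𝓘(ℝ, E) (minSmoothness ℝ 3) N := .of_le (n := ∞) (by simpa using ENat.LEInfty.out)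
  refine (contMDiff_mulInvariantVectorField Y).of_le ?_
  simp

/-- Integral curves of a left-invariant vector field are the left translates of a one-parameter
subgroup. -/
theorem exists_oneParameterSubgroup [CompleteSpace E] [T2Space N] (Y : GroupLieAlgebra 𝓘(ℝ, E) N) :
    ∃ c : ℝ → N, Continuous c ∧ (∀ s t, c (s + t) = c s * c t) ∧ c 0 = 1 ∧
      (Y ≠ 0 → ∃ t, c t ≠ 1) ∧ IsMIntegralCurve c (mulInvariantVectorField Y) ∧
      ∀ γ : ℝ → N, IsMIntegralCurve γ (mulInvariantVectorField Y) → ∀ t, γ t = γ 0 * c t := by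
  have hV := contMDiff_one_mulInvariantVectorField Y
  have : IsManifold 𝓘(ℝ, E) 1 N := .of_le (n := ∞) (by simp)
  obtain ⟨γ, hγ0, hγ⟩ :=
    exists_isMIntegralCurveAt_of_contMDiffAt_boundaryless 0 (hV.contMDiffAt (x := (1 : N)))
  obtain ⟨ε, hε, hγ⟩ := isMIntegralCurveAt_iff'.1 hγ
  -- Left translation makes the existence time `ε` uniform in the starting point, which gives
  -- completeness.
  obtain ⟨c, hc0, hc⟩ := exists_isMIntegralCurve_of_isMIntegralCurveOn hV hε (fun x =>
    ⟨fun t => x * γ t, by simp [hγ0], by simpa [Real.ball_eq_Ioo] using hγ.mul_left x⟩) 1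
  have huniq : ∀ γ : ℝ → N, IsMIntegralCurve γ (mulInvariantVectorField Y) →
      ∀ t, γ t = γ 0 * c t := fun γ hγ => congrFun <|
    isMIntegralCurve_Ioo_eq_of_contMDiff_boundaryless (t₀ := 0) hV hγ (hc.mul_left (γ 0))
      (by simp [hc0])
  refine ⟨c, hc.continuous, fun s t => ?_, hc0, fun hY => ?_, hc, huniq⟩
  · have := huniq _ (hc.comp_add s) t
    simpa [add_comm] using this
  · by_contra! h
    apply hY
    have h1 := hc 0
    obtain rfl : c = fun _ => 1 := funext h
    have h2 := hasMFDerivAt_unique h1 (hasMFDerivAt_const (1 : N) (0 : ℝ))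
    have h3 := DFunLike.congr_fun h2 (1 : ℝ)
    have h4 : mulInvariantVectorField Y (1 : N) = Y := by
      have hd : HasMFDerivAt 𝓘(ℝ, E) 𝓘(ℝ, E) (fun x : N => 1 * x) 1 (1 : E →L[ℝ] E) := by
        have h : HasMFDerivAt 𝓘(ℝ, E) 𝓘(ℝ, E) (id : N → N) 1 (1 : E →L[ℝ] E) := hasMFDerivAt_id 1
        have e : (fun x : N => 1 * x) = id := funext fun x => _root_.one_mul x
        exact e ▸ h
      exact DFunLike.congr_fun hd.mfderiv Y
    have h5 : mulInvariantVectorField Y (1 : N) = 0 := by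
      have h6 : (1 : ℝ) • mulInvariantVectorField Y (1 : N) = 0 := h3
      rwa [one_smul] at h6
    exact h4.symm.trans h5

end OneParameterSubgroups

/-! ### Differences along right translations -/

section Differences

variable {E : Type*} [NormedAddCommGroup E] [NormedSpace ℝ E]
  {N : Type*} [TopologicalSpace N] [ChartedSpace E N] [Group N] [LieGroup 𝓘(ℝ, E) ∞ N]

/-- The difference of a function along a right translation has zero integrals along the orbits of
a left-invariant vector field, if this translation belongs to a proper one-parameter subgroup
generated by the vector field. -/
theorem hasZeroOrbitIntegrals_sub {Y : GroupLieAlgebra 𝓘(ℝ, E) N} {c : ℝ → N}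
    (hc : Continuous c) (hadd : ∀ s t, c (s + t) = c s * c t) (hc0 : c 0 = 1)
    (hcY : IsMIntegralCurve c (mulInvariantVectorField Y))
    (huniq : ∀ γ : ℝ → N, IsMIntegralCurve γ (mulInvariantVectorField Y) →
      ∀ t, γ t = γ 0 * c t)
    (hproper : ∀ K : Set N, IsCompact K → ∃ R : ℝ, ∀ t, c t ∈ K → |t| ≤ R)
    {h : N → ℝ} (hh : Continuous h) (hK : HasCompactSupport h) (s : ℝ) :
    HasZeroOrbitIntegrals (mulInvariantVectorField Y) fun x => h (x * c s) - h x := by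
  have := topologicalGroup_of_lieGroup 𝓘(ℝ, E) ∞ (G := N)
  refine ⟨fun x => ⟨fun t => x * c t, by simp [hc0], hcY.mul_left x⟩, fun γ hγ => ?_⟩
  have hγc : γ = fun t => γ 0 * c t := funext (huniq γ hγ)
  have hint : MeasureTheory.Integrable fun t => h (γ 0 * c t) := by
    refine Continuous.integrable_of_hasCompactSupport (by fun_prop) ?_
    obtain ⟨R, hR⟩ := hproper _ (hK.isCompact.image (continuous_const_mul (γ 0)⁻¹))
    refine HasCompactSupport.intro (isCompact_Icc (a := -R) (b := R)) fun t ht => ?_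
    by_contra hne
    exact ht (abs_le.1 (hR t ⟨_, subset_tsupport h hne, by simp⟩))
  have heq : (fun t => h (γ t * c s) - h (γ t)) =
      fun t => (fun t => h (γ 0 * c t)) (t + s) - (fun t => h (γ 0 * c t)) t := by
    funext t
    simp only [hadd]
    rw [huniq γ hγ t, mul_assoc]
  simp only [heq]
  refine ⟨(hint.comp_add_right s).sub hint, ?_⟩
  rw [MeasureTheory.integral_sub (hint.comp_add_right s) hint,
    MeasureTheory.integral_add_right_eq_self (fun t => h (γ 0 * c t)), sub_self]

/-- A compactly supported function invariant under right translation by a nontrivial element of a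
proper one-parameter subgroup vanishes. -/
theorem eq_zero_of_mul_right_eq [IsTopologicalGroup N] {c : ℝ → N}
    (hadd : ∀ s t, c (s + t) = c s * c t)
    (hproper : ∀ K : Set N, IsCompact K → ∃ R : ℝ, ∀ t, c t ∈ K → |t| ≤ R)
    {h : N → ℝ} (hK : HasCompactSupport h) (hinv : ∀ x, h (x * c 1) = h x) : h = 0 := by
  funext x
  by_contra hne
  -- A nonzero value would recur at unboundedly many times inside the compact support, against
  -- properness.
  have hn : ∀ n : ℕ, h (x * c (n + 1)) = h x := by
    intro n
    induction n with
    | zero => simpa using hinv x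
    | succ n ih => rw [Nat.cast_succ, hadd, ← mul_assoc, hinv, ih]
  obtain ⟨R, hR⟩ := hproper _ (hK.isCompact.image (continuous_const_mul x⁻¹))
  obtain ⟨n, hn'⟩ := exists_nat_gt R
  have h1 := hR (n + 1) ⟨x * c (n + 1), subset_tsupport h (by
    rw [Function.mem_support, hn]; exact hne), by simp⟩
  have h2 := le_abs_self ((n : ℝ) + 1)
  linarith

/-- Right translates of smooth compactly supported functions. -/
theorem ContMDiff.comp_mul_right {h : N → ℝ} (hh : ContMDiff 𝓘(ℝ, E) 𝓘(ℝ, ℝ) ∞ h) (a : N) :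
    ContMDiff 𝓘(ℝ, E) 𝓘(ℝ, ℝ) ∞ fun x => h (x * a) :=
  hh.comp contMDiff_mul_right

theorem HasCompactSupport.comp_mul_right [IsTopologicalGroup N] {h : N → ℝ}
    (hh : HasCompactSupport h) (a : N) : HasCompactSupport fun x => h (x * a) :=
  hh.comp_homeomorph (Homeomorph.mulRight a)

/-- In a nilpotent Lie group, differences along two right translations have a common nonzero
multiple among the smooth compactly supported functions. -/
theorem exists_sub_eq_sub [IsTopologicalGroup N] [Group.IsNilpotent N] {t : N}
    (ht : ∀ h : N → ℝ, HasCompactSupport h → (∀ x, h (x * t) = h x) → h = 0)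
    {g : N → ℝ} (hg0 : g ≠ 0) (hg : ContMDiff 𝓘(ℝ, E) 𝓘(ℝ, ℝ) ∞ g)
    (hgK : HasCompactSupport g) (y : N) :
    ∃ h k : N → ℝ, h ≠ 0 ∧ ContMDiff 𝓘(ℝ, E) 𝓘(ℝ, ℝ) ∞ h ∧ HasCompactSupport h ∧
      ContMDiff 𝓘(ℝ, E) 𝓘(ℝ, ℝ) ∞ k ∧ HasCompactSupport k ∧
      ∀ x, h (x * y) - h x = k (x * t) - k x := by
  obtain ⟨n, hn⟩ := Group.IsNilpotent.nilpotent N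
  -- The induction measures how far `y` is from `t`: passing from `y` to `y * t * y⁻¹` replaces `y *
  -- t⁻¹` by its commutator with `t`, one term lower.
  have hy : y * t⁻¹ ∈ Subgroup.upperCentralSeries N n := hn ▸ Subgroup.mem_top _
  clear hn
  induction n generalizing y with
  | zero =>
    obtain rfl : y = t := by simpa [mul_inv_eq_one] using hy
    exact ⟨g, g, hg0, hg, hgK, hg, hgK, fun x => rfl⟩
  | succ n ih =>
    have hy' : y * t * y⁻¹ * t⁻¹ ∈ Subgroup.upperCentralSeries N n := by
      have := (Subgroup.mem_upperCentralSeries_succ_iff.1 hy) t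
      simpa [commutatorElement_def, mul_assoc] using this
    obtain ⟨h, k, h0, hh, hhK, hk, hkK, heq⟩ := ih (y * t * y⁻¹) hy'
    -- With `R_g` for right translation of functions and `u = R_{y⁻¹} h`, the new pair is `(R_t - 1)
    -- u` and `k - u`. As `R_y R_t u = R_{y * t * y⁻¹} h` and `R_y u = h`, the terms not covered by
    -- `heq` cancel.
    refine ⟨fun x => h (x * t * y⁻¹) - h (x * y⁻¹), fun x => k x - h (x * y⁻¹), fun hzero => ?_,
      ((hh.comp_mul_right y⁻¹).comp_mul_right t).sub (hh.comp_mul_right y⁻¹),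
      ((hhK.comp_mul_right y⁻¹).comp_mul_right t).sub (hhK.comp_mul_right y⁻¹),
      hk.sub (hh.comp_mul_right y⁻¹), hkK.sub (hhK.comp_mul_right y⁻¹), fun x => ?_⟩
    · apply h0
      have h1 := ht _ (hhK.comp_mul_right y⁻¹) fun x => sub_eq_zero.1 (congrFun hzero x)
      funext x
      simpa using congrFun h1 (x * y)
    · have := heq x
      simp only [mul_assoc, mul_inv_cancel, _root_.mul_one] at this ⊢
      linarith

theorem exists_contMDiff_hasCompactSupport_ne_zero [FiniteDimensional ℝ E] [T2Space N] :
    ∃ g : N → ℝ, g ≠ 0 ∧ ContMDiff 𝓘(ℝ, E) 𝓘(ℝ, ℝ) ∞ g ∧ HasCompactSupport g := by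
  let g : SmoothBumpFunction 𝓘(ℝ, E) (1 : N) := Classical.choice inferInstance
  exact ⟨g, fun h => by simpa [g.eq_one] using congrFun h 1, g.contMDiff, g.hasCompactSupport⟩

end Differences

end Preliminaries

theorem mainTheorem10 {E : Type*} [NormedAddCommGroup E] [NormedSpace ℝ E]
    [FiniteDimensional ℝ E] {N : Type*} [TopologicalSpace N] [T2Space N] [ChartedSpace E N]
    [Group N] [LieGroup 𝓘(ℝ, E) ∞ N] [ConnectedSpace N] [SimplyConnectedSpace N]
    [Group.IsNilpotent N] (Y T : GroupLieAlgebra 𝓘(ℝ, E) N) (hY : Y ≠ 0) (hT : T ≠ 0) :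
    ∃ f : N → ℝ, f ≠ 0 ∧ ContMDiff 𝓘(ℝ, E) 𝓘(ℝ, ℝ) ∞ f ∧ HasCompactSupport f ∧
      HasZeroOrbitIntegrals (mulInvariantVectorField Y) f ∧
      HasZeroOrbitIntegrals (mulInvariantVectorField T) f := by
  have := FiniteDimensional.complete ℝ E
  have := topologicalGroup_of_lieGroup 𝓘(ℝ, E) ∞ (G := N)
  obtain ⟨a, ha, haadd, ha0, hane, haY, hau⟩ := exists_oneParameterSubgroup Y
  obtain ⟨b, hb, hbadd, hb0, hbne, hbT, hbu⟩ := exists_oneParameterSubgroup T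
  have haproper : ∀ K : Set N, IsCompact K → ∃ R : ℝ, ∀ t, a t ∈ K → |t| ≤ R := fun K hK =>
    exists_abs_le_of_mem_isCompact_of_simplyConnectedSpace (E := E) ha haadd (hane hY) hK
  have hbproper : ∀ K : Set N, IsCompact K → ∃ R : ℝ, ∀ t, b t ∈ K → |t| ≤ R := fun K hK =>
    exists_abs_le_of_mem_isCompact_of_simplyConnectedSpace (E := E) hb hbadd (hbne hT) hK
  obtain ⟨g, hg0, hg, hgK⟩ := exists_contMDiff_hasCompactSupport_ne_zero (E := E) (N := N)
  obtain ⟨h, k, h0, hh, hhK, hk, hkK, heq⟩ := exists_sub_eq_sub (t := b 1)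
    (fun _ hK hinv => eq_zero_of_mul_right_eq hbadd hbproper hK hinv) hg0 hg hgK (a 1)
  refine ⟨fun x => h (x * a 1) - h x, fun hzero => h0 ?_, (hh.comp_mul_right _).sub hh,
    (hhK.comp_mul_right _).sub hhK, ?_, ?_⟩
  · exact eq_zero_of_mul_right_eq haadd haproper hhK fun x => sub_eq_zero.1 (congrFun hzero x)
  · exact hasZeroOrbitIntegrals_sub ha haadd ha0 haY hau haproper hh.continuous hhK 1
  -- The same function is also a difference along `b 1`, now of `k`.
  · simp only [heq]
    exact hasZeroOrbitIntegrals_sub hb hbadd hb0 hbT hbu hbproper hk.continuous hkK 1
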